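/- Let $E_6$ be the root lattice with simple roots $\alpha_1,\dots,\alpha_6$ (Bourbaki numbering, with $(\alpha_i,\alpha_i)=2$); its roots are the vectors $r\in E_6$ with $r^2=(r,r)=2$. Let $J$ be the involution of $E_6$ induced by the symmetry of the Dynkin diagram: $J(\alpha_1)=\alpha_6$, $J(\alpha_6)=\alpha_1$, $J(\alpha_3)=\alpha_5$, $J(\alpha_5)=\alpha_3$, $J(\alpha_2)=\alpha_2$, $J(\alpha_4)=\alpha_4$. Put $D_4^+=\{l\in E_6 : J(l)=l\}$. Let $d\ge 1$ be an integer. Then there exists a vector $l\in D_4^+$ with $l^2=2d$ such that the number of roots of $E_6$ orthogonal to $l$ is at least $1$ and smaller than $18$ if and only if $d\neq 2^n$ for every integer $n\ge 0$. -/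

import Mathlib

namespace E6

/-- The root lattice `E₆`, in coordinates with respect to the simple roots `α₁, …, α₆`
(Bourbaki numbering; the coordinate of `αₖ` has index `k - 1`). -/
abbrev Lattice : Type := Fin 6 → ℤ

/-- The `k`-th simple root; `simpleRoot k` is `αₖ₊₁` in Bourbaki's numbering. -/
def simpleRoot (k : Fin 6) : Lattice := Pi.single k 1

/-- The bilinear form of the lattice `E₆`: its Gram matrix in the basis of simple roots is
the Cartan matrix of type `E₆`. -/
noncomputable def form : LinearMap.BilinForm ℤ Lattice := Matrix.toBilin' CartanMatrix.E₆

/-- The roots of `E₆` are the lattice vectors of square `2`. -/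
def IsRoot (r : Lattice) : Prop := form r r = 2

/-- The permutation of the nodes given by the non-trivial symmetry of the Dynkin diagram:
`α₁ ↔ α₆`, `α₃ ↔ α₅`, with `α₂` and `α₄` fixed. -/
def diagramSymmetry : Equiv.Perm (Fin 6) := Equiv.swap 0 5 * Equiv.swap 2 4

/-- The involution `J` of `E₆` induced by the symmetry of the Dynkin diagram. -/
def J : Lattice ≃ₗ[ℤ] Lattice := LinearEquiv.funCongrLeft ℤ ℤ diagramSymmetry

/-- The `J`-invariant sublattice `D₄⁺ = {l ∈ E₆ | J l = l}`. -/
def D4Plus : Submodule ℤ Lattice where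
  carrier := {l | J l = l}
  zero_mem' := map_zero J
  add_mem' {a b} ha hb := by
    change J (a + b) = a + b
    rw [map_add, show J a = a from ha, show J b = b from hb]
  smul_mem' c a ha := by
    change J (c • a) = c • a
    rw [map_smul, show J a = a from ha]

/-- The roots of `E₆` orthogonal to `l`. -/
def orthogonalRoots (l : Lattice) : Set Lattice := {r | IsRoot r ∧ form l r = 0}

theorem form_simpleRoot (i j : Fin 6) :
    form (simpleRoot i) (simpleRoot j) = CartanMatrix.E₆ i j := by
  simp [form, simpleRoot]

theorem J_simpleRoot (k : Fin 6) : J (simpleRoot k) = simpleRoot (diagramSymmetry k) := by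
  revert k; decide

end E6

namespace E6

/-! Dominant vectors of `D4Plus` are given by inner products m₁, …, m₄ ≥ 0 with α₂, α₄, α₃, α₁; such
a vector is orthogonal to a simple root exactly when some mᵢ = 0. On the walls m₁ = 0 and m₂ = 0, d
is a sum of three squares; on m₃ = 0 and m₄ = 0, 2d is. Only the edges spanned by m₁ (d = k²) and m₄
(d = 2k²) have 18 or more orthogonal roots.

If d is neither k² nor 2k², removing factors 4 leaves d or 2d congruent to 2 mod 4, hence a sum of
three squares. If it is, with k not a power of 2, an odd prime p divides k, and a representation of
p² with two non-zero terms avoids both edges.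

For d = 2ⁿ, a vector orthogonal to a root with 4 ∣ d is twice another one (`exists_two_smul`), so
descent leads to squares 2 and 4, a finite check. -/

/-! ### Sums of three squares -/

theorem exists_shear (k m : ℤ) (hm : 0 < m) : ∃ u : ℤ, 2 * |k + u * m| ≤ m := by
  refine ⟨-((2 * k + m) / (2 * m)), ?_⟩
  have h1 := Int.emod_nonneg (2 * k + m) (b := 2 * m) (by omega)
  have h2 := Int.emod_lt_of_pos (2 * k + m) (b := 2 * m) (by omega)
  have h3 := Int.emod_add_mul_ediv (2 * k + m) (2 * m)
  set q := (2 * k + m) / (2 * m)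
  have : 2 * |k + -q * m| = |2 * (k + -q * m)| := by rw [abs_mul]; rfl
  rw [this, abs_le]
  constructor <;> nlinarith

/-- A positive definite integral ternary quadratic form of determinant `1` takes only values that
are sums of three squares. -/
theorem ternary_form_sum_three_squares (a b c r s t : ℤ) (ha : 0 < a) (hB : 0 < a * b - t ^ 2)
    (hdet : a * b * c + 2 * r * s * t - a * r ^ 2 - b * s ^ 2 - c * t ^ 2 = 1) (x y z : ℤ) :
    ∃ p q w : ℤ, a * x ^ 2 + b * y ^ 2 + c * z ^ 2 + 2 * r * y * z + 2 * s * x * z + 2 * t * x * y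
      = p ^ 2 + q ^ 2 + w ^ 2 := by
  -- Reduction by induction on a, then on the minor B = ab - t². Shears preserve both; exchanging y
  -- and z lowers B, exchanging x and y lowers a.
  obtain ⟨N, hN⟩ : ∃ N : ℕ, a.toNat = N := ⟨_, rfl⟩
  obtain ⟨M, hM⟩ : ∃ M : ℕ, (a * b - t ^ 2).toNat = M := ⟨_, rfl⟩
  induction N using Nat.strong_induction_on generalizing a b c r s t x y z M with
  | _ N ihN =>
  induction M using Nat.strong_induction_on generalizing a b c r s t x y z with
  | _ M ihM =>
  obtain ⟨u, hu⟩ := exists_shear (a * r - s * t) (a * b - t ^ 2) hB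
  wlog hu0 : u = 0 generalizing c r s u z y x
  · obtain ⟨p, q, w, h⟩ := this (c + 2 * u * r + u ^ 2 * b) (r + u * b) (s + u * t)
      (by linear_combination hdet) x (y - u * z) z 0
      (by convert hu using 3; ring) rfl
    exact ⟨p, q, w, by linear_combination h⟩
  subst hu0
  have key : (a * b - t ^ 2) * (a * c - s ^ 2) - (a * r - s * t) ^ 2 = a := by
    linear_combination a * hdet
  have hC : 0 < a * c - s ^ 2 := by nlinarith [sq_nonneg (a * r - s * t)]
  by_cases hBC : a * c - s ^ 2 < a * b - t ^ 2
  · obtain ⟨p, q, w, h⟩ := ihM (a * c - s ^ 2).toNat (by omega) a c b r t s ha hC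
      (by linear_combination hdet) x z y hN rfl
    exact ⟨p, q, w, by linear_combination h⟩
  rw [zero_mul, add_zero] at hu
  have hR : 4 * (a * r - s * t) ^ 2 ≤ (a * b - t ^ 2) ^ 2 := by
    have := pow_le_pow_left₀ (by positivity) hu 2
    rw [mul_pow, sq_abs] at this
    linarith
  have h3B : 3 * (a * b - t ^ 2) ^ 2 ≤ 4 * a := by nlinarith
  obtain ⟨u, hut⟩ := exists_shear t a ha
  wlog hu0 : u = 0 generalizing b r t u x
  · have e : a * (b + 2 * u * t + u ^ 2 * a) - (t + u * a) ^ 2 = a * b - t ^ 2 := by ring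
    have e' : a * (r + u * s) - s * (t + u * a) = a * r - s * t := by ring
    obtain ⟨p, q, w, h⟩ := this (b + 2 * u * t + u ^ 2 * a) (t + u * a)
      (by rwa [e]) (by rwa [e]) (r + u * s) (by linear_combination hdet) (x - u * y)
      (by rwa [e, e']) (by rw [e, e']; exact key) (by rwa [e]) (by rwa [e, e']) (by rwa [e]) 0
      (by simpa using hut) rfl
    exact ⟨p, q, w, by linear_combination h⟩
  subst hu0
  rw [zero_mul, add_zero] at hut
  by_cases hab : b < a
  · have hb : 0 < b := by nlinarith [sq_nonneg t]
    obtain ⟨p, q, w, h⟩ := ihN b.toNat (by omega) b a c s r t hb (by linarith)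
      (by linear_combination hdet) y x z rfl _ rfl
    exact ⟨p, q, w, by linear_combination h⟩
  have ht : 4 * t ^ 2 ≤ a ^ 2 := by
    have := pow_le_pow_left₀ (by positivity) hut 2
    rw [mul_pow, sq_abs] at this
    linarith
  have h3a : 3 * a ^ 2 ≤ 4 * (a * b - t ^ 2) := by nlinarith
  -- The bounds 3B² ≤ 4a and 3a² ≤ 4B give 27a³ ≤ 64.
  have ha1 : a = 1 := by
    by_contra hne
    have h2 : 2 ≤ a := by omega
    have h4 : (3 * a ^ 2) ^ 2 ≤ (4 * (a * b - t ^ 2)) ^ 2 := pow_le_pow_left₀ (by positivity) h3a 2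
    have h5 : 27 * a ^ 4 ≤ 64 * a := by nlinarith
    have h6 : 8 ≤ a ^ 3 := by nlinarith [sq_nonneg (a - 2), sq_nonneg a]
    nlinarith
  subst ha1
  have ht0 : t = 0 := by
    have := abs_nonneg t
    exact abs_eq_zero.mp (by omega)
  subst ht0
  have hb1 : b = 1 := by nlinarith
  subst hb1
  simp at hu
  have hr0 : r = 0 := by
    have := abs_nonneg r
    exact abs_eq_zero.mp (by omega)
  subst hr0
  exact ⟨x + s * z, y, z, by linear_combination (z ^ 2) * hdet⟩

/-- Dirichlet gives a prime p = (4j+1)n - 1, and reciprocity makes -(4j+1) a square mod p, so ap =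
t² + 4j + 1. The matrix [[a,t,1],[t,p,0],[1,0,n]] then has determinant 1 and represents n. -/
theorem sum_three_squares_of_mod_four_eq_two (n : ℕ) (hn : n % 4 = 2) :
    ∃ x y z : ℤ, x ^ 2 + y ^ 2 + z ^ 2 = n := by
  have hcop : Nat.Coprime (n - 1) (4 * n) := by
    apply Nat.Coprime.mul_right
    · have h : Nat.Coprime (n - 1) 2 := by
        rw [Nat.coprime_two_right, Nat.odd_iff]; omega
      exact h.pow_right 2
    · rw [Nat.coprime_comm]
      exact (Nat.coprime_self_sub_right (by omega : 1 ≤ n)).mpr (by simp)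
  have : NeZero (4 * n) := ⟨by omega⟩
  obtain ⟨p, hpn, hp, hpe⟩ := Nat.forall_exists_prime_gt_and_eq_mod
    ((ZMod.isUnit_iff_coprime _ _).mpr hcop) (4 * n)
  rw [ZMod.natCast_eq_natCast_iff] at hpe
  obtain ⟨j, hj⟩ : ∃ j, p = 4 * n * j + (n - 1) := by
    refine ⟨p / (4 * n), ?_⟩
    have h1 : p % (4 * n) = n - 1 := by
      rw [hpe]; exact Nat.mod_eq_of_lt (by omega)
    have := Nat.div_add_mod p (4 * n)
    omega
  have hpd : (p : ℤ) = (4 * j + 1 : ℕ) * n - 1 := by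
    rw [hj]; push_cast [show 1 ≤ n by omega]; ring
  have hp4 : p % 4 = 1 := by
    rw [hj, mul_assoc, Nat.mul_add_mod]; omega
  have := Fact.mk hp
  have hleg : legendreSym p (-((4 * j + 1 : ℕ) : ℤ)) = 1 := by
    rw [jacobiSym.legendreSym.to_jacobiSym, neg_eq_neg_one_mul, jacobiSym.mul_left,
      jacobiSym.at_neg_one (hp.odd_of_ne_two (by omega)), ZMod.χ₄_nat_one_mod_four hp4, one_mul,
      jacobiSym.quadratic_reciprocity_one_mod_four (by omega) (hp.odd_of_ne_two (by omega)),
      jacobiSym.mod_left, hpd, sub_eq_add_neg, Int.mul_add_emod_self_left, ← jacobiSym.mod_left,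
      jacobiSym.at_neg_one (by rw [Nat.odd_iff]; omega), ZMod.χ₄_nat_one_mod_four (by omega)]
  obtain ⟨q, hq⟩ := (legendreSym.eq_one_iff p (by
    intro h0
    rw [(legendreSym.eq_zero_iff p _).mpr h0] at hleg
    exact zero_ne_one hleg)).mp hleg
  obtain ⟨t, rfl⟩ := ZMod.intCast_surjective q
  obtain ⟨a, ha⟩ : (p : ℤ) ∣ t ^ 2 + (4 * j + 1 : ℕ) := by
    rw [← ZMod.intCast_zmod_eq_zero_iff_dvd]
    push_cast at hq ⊢
    linear_combination -hq
  have hp0 : (0 : ℤ) < p := by exact_mod_cast hp.pos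
  have ha0 : 0 < a := by
    push_cast at ha
    by_contra h
    nlinarith [sq_nonneg t]
  obtain ⟨x, y, z, h⟩ := ternary_form_sum_three_squares a p n 0 1 t ha0
    (by push_cast at ha; nlinarith) (by linear_combination (-(n : ℤ)) * ha - hpd) 0 0 1
  exact ⟨x, y, z, by linear_combination -h⟩

/-- The square of an odd prime is a sum of three squares, at least two of them non-zero. -/
theorem prime_sq_sum_three_squares (p : ℕ) (hp : p.Prime) (hp2 : p ≠ 2) :
    ∃ x y z : ℤ, x ≠ 0 ∧ y ≠ 0 ∧ x ^ 2 + y ^ 2 + z ^ 2 = p ^ 2 := by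
  obtain ⟨a, b, c, d, h, hab, hcd⟩ : ∃ a b c d : ℤ, a ^ 2 + b ^ 2 + c ^ 2 + d ^ 2 = p ∧
      a ^ 2 + b ^ 2 ≠ 0 ∧ c ^ 2 + d ^ 2 ≠ 0 := by
    obtain ⟨a, b, c, d, h⟩ := Nat.sum_four_squares p
    have hsq (k : ℕ) : k ^ 2 ≠ p := fun hk => by
      rw [← hk] at hp; exact hp.not_isSquare ⟨k, sq k⟩
    have h' : (a ^ 2 + b ^ 2 + c ^ 2 + d ^ 2 : ℤ) = p := by exact_mod_cast h
    have ne {u v : ℕ} (huv : u ≠ 0 ∨ v ≠ 0) : (u ^ 2 + v ^ 2 : ℤ) ≠ 0 := by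
      norm_cast; rcases huv with hh | hh <;> positivity
    have := hsq a
    have := hsq b
    have := hsq c
    have := hsq d
    by_cases h1 : (a ≠ 0 ∨ b ≠ 0) ∧ (c ≠ 0 ∨ d ≠ 0)
    · exact ⟨a, b, c, d, h', ne h1.1, ne h1.2⟩
    · refine ⟨a, c, b, d, by linear_combination h', ne ?_, ne ?_⟩ <;> grind
  have hodd : (p : ℤ) % 2 = 1 := by
    have := hp.eq_two_or_odd; omega
  -- The terms are those of Lebesgue's identity for (a²+b²+c²+d²)²; the last two cannot both vanish,
  -- as (ac+bd)² + (ad-bc)² = (a²+b²)(c²+d²).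
  have hx : a ^ 2 + b ^ 2 - c ^ 2 - d ^ 2 ≠ 0 := by
    intro h0
    have : (p : ℤ) = 2 * (c ^ 2 + d ^ 2) := by linarith
    omega
  by_cases hy : a * c + b * d = 0
  · refine ⟨_, 2 * (a * d - b * c), 2 * (a * c + b * d), hx, fun h0 => ?_, by rw [← h]; ring⟩
    have h0 : a * d - b * c = 0 := by linarith
    apply mul_ne_zero hab hcd
    linear_combination (a * c + b * d) * hy + (a * d - b * c) * h0
  · exact ⟨_, 2 * (a * c + b * d), 2 * (a * d - b * c), hx, by simpa using hy, by rw [← h]; ring⟩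

/-! ### Coordinates and the list of roots -/

theorem form_apply (l r : Lattice) : form l r =
    l 0 * (2 * r 0 - r 2) + l 1 * (2 * r 1 - r 3) + l 2 * (2 * r 2 - r 0 - r 3) +
    l 3 * (2 * r 3 - r 1 - r 2 - r 4) + l 4 * (2 * r 4 - r 3 - r 5) + l 5 * (2 * r 5 - r 4) := by
  simp [form, Matrix.toBilin'_apply, Fin.sum_univ_six, CartanMatrix.E₆]
  ring

theorem mem_D4Plus_iff (l : Lattice) : l ∈ D4Plus ↔ l 0 = l 5 ∧ l 2 = l 4 := by
  change J l = l ↔ _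
  have h (i : Fin 6) : J l i = l (diagramSymmetry i) := rfl
  constructor
  · intro hl
    have h0 := congrFun hl 0
    have h2 := congrFun hl 2
    rw [h] at h0 h2
    exact ⟨h0.symm, h2.symm⟩
  · rintro ⟨h0, h2⟩
    funext i
    rw [h]
    fin_cases i
    · exact h0.symm
    · rfl
    · exact h2.symm
    · rfl
    · exact h2
    · exact h0

/-- The coordinates of the positive roots. -/
def positiveRoots : List (ℤ × ℤ × ℤ × ℤ × ℤ × ℤ) :=
  [(0, 0, 0, 0, 0, 1), (0, 0, 0, 0, 1, 0), (0, 0, 0, 0, 1, 1), (0, 0, 0, 1, 0, 0),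
   (0, 0, 0, 1, 1, 0), (0, 0, 0, 1, 1, 1), (0, 0, 1, 0, 0, 0), (0, 0, 1, 1, 0, 0),
   (0, 0, 1, 1, 1, 0), (0, 0, 1, 1, 1, 1), (0, 1, 0, 0, 0, 0), (0, 1, 0, 1, 0, 0),
   (0, 1, 0, 1, 1, 0), (0, 1, 0, 1, 1, 1), (0, 1, 1, 1, 0, 0), (0, 1, 1, 1, 1, 0),
   (0, 1, 1, 1, 1, 1), (0, 1, 1, 2, 1, 0), (0, 1, 1, 2, 1, 1), (0, 1, 1, 2, 2, 1),
   (1, 0, 0, 0, 0, 0), (1, 0, 1, 0, 0, 0), (1, 0, 1, 1, 0, 0), (1, 0, 1, 1, 1, 0),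
   (1, 0, 1, 1, 1, 1), (1, 1, 1, 1, 0, 0), (1, 1, 1, 1, 1, 0), (1, 1, 1, 1, 1, 1),
   (1, 1, 1, 2, 1, 0), (1, 1, 1, 2, 1, 1), (1, 1, 1, 2, 2, 1), (1, 1, 2, 2, 1, 0),
   (1, 1, 2, 2, 1, 1), (1, 1, 2, 2, 2, 1), (1, 1, 2, 3, 2, 1), (1, 2, 2, 3, 2, 1)]

/-- The coordinates of the roots. -/
def rootList : List (ℤ × ℤ × ℤ × ℤ × ℤ × ℤ) :=
  positiveRoots ++ positiveRoots.map fun r => -r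

/-- The coordinates of a lattice vector, as a tuple. -/
def coords (r : Lattice) : ℤ × ℤ × ℤ × ℤ × ℤ × ℤ := (r 0, r 1, r 2, r 3, r 4, r 5)

/-- The lattice vector with given coordinates. -/
def ofCoords (v : ℤ × ℤ × ℤ × ℤ × ℤ × ℤ) : Lattice :=
  ![v.1, v.2.1, v.2.2.1, v.2.2.2.1, v.2.2.2.2.1, v.2.2.2.2.2]

theorem ofCoords_coords (r : Lattice) : ofCoords (coords r) = r := by
  funext i; fin_cases i <;> rfl

theorem coords_ofCoords (v : ℤ × ℤ × ℤ × ℤ × ℤ × ℤ) : coords (ofCoords v) = v := rfl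

/-- The integers from `-n` to `n`. -/
def intsUpTo (n : ℕ) : List ℤ := (List.range (2 * n + 1)).map fun k : ℕ => (k : ℤ) - n

theorem mem_intsUpTo {n : ℕ} {x : ℤ} (h : x ^ 2 < (n + 1) ^ 2) : x ∈ intsUpTo n := by
  have := abs_lt.mp (abs_lt_of_sq_lt_sq h (by positivity))
  refine List.mem_map.mpr ⟨(x + n).toNat, List.mem_range.mpr ?_, ?_⟩ <;> omega

theorem mem_rootList_of_small :
    ∀ a ∈ intsUpTo 1, ∀ f ∈ intsUpTo 1, ∀ b ∈ intsUpTo 2, ∀ c ∈ intsUpTo 2, ∀ e ∈ intsUpTo 2,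
      ∀ d ∈ intsUpTo 3, a * a + b * b + c * c + d * d + e * e + f * f
        - a * c - c * d - b * d - d * e - e * f = 1 → (a, b, c, d, e, f) ∈ rootList := by
  decide +kernel

/-- Cauchy–Schwarz against the fundamental weights, whose squares are 4/3, 2, 10/3, 6, 10/3, 4/3. -/
theorem sq_le_of_form (r : Lattice) : 3 * r 0 ^ 2 ≤ 4 * form r r ∧ r 1 ^ 2 ≤ 2 * form r r ∧
    3 * r 2 ^ 2 ≤ 10 * form r r ∧ r 3 ^ 2 ≤ 6 * form r r ∧ 3 * r 4 ^ 2 ≤ 10 * form r r ∧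
    3 * r 5 ^ 2 ≤ 4 * form r r := by
  rw [form_apply]
  refine ⟨?_, ?_, ?_, ?_, ?_, ?_⟩
  · nlinarith [sq_nonneg (2 * r 1 - 1 * r 3),
      sq_nonneg (2 * r 5 - 1 * r 4),
      sq_nonneg (3 * r 4 - 2 * r 3),
      sq_nonneg (5 * r 3 - 6 * r 2),
      sq_nonneg (4 * r 2 - 5 * r 0)]
  · nlinarith [sq_nonneg (2 * r 0 - 1 * r 2),
      sq_nonneg (3 * r 2 - 2 * r 3),
      sq_nonneg (2 * r 5 - 1 * r 4),
      sq_nonneg (3 * r 4 - 2 * r 3),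
      sq_nonneg (2 * r 3 - 3 * r 1)]
  · nlinarith [sq_nonneg (2 * r 0 - 1 * r 2),
      sq_nonneg (2 * r 1 - 1 * r 3),
      sq_nonneg (2 * r 5 - 1 * r 4),
      sq_nonneg (3 * r 4 - 2 * r 3),
      sq_nonneg (5 * r 3 - 6 * r 2)]
  · nlinarith [sq_nonneg (2 * r 0 - 1 * r 2),
      sq_nonneg (3 * r 2 - 2 * r 3),
      sq_nonneg (2 * r 1 - 1 * r 3),
      sq_nonneg (2 * r 5 - 1 * r 4),
      sq_nonneg (3 * r 4 - 2 * r 3)]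
  · nlinarith [sq_nonneg (2 * r 0 - 1 * r 2),
      sq_nonneg (3 * r 2 - 2 * r 3),
      sq_nonneg (2 * r 1 - 1 * r 3),
      sq_nonneg (5 * r 3 - 6 * r 4),
      sq_nonneg (2 * r 5 - 1 * r 4)]
  · nlinarith [sq_nonneg (2 * r 0 - 1 * r 2),
      sq_nonneg (3 * r 2 - 2 * r 3),
      sq_nonneg (2 * r 1 - 1 * r 3),
      sq_nonneg (5 * r 3 - 6 * r 4),
      sq_nonneg (4 * r 4 - 5 * r 5)]

theorem coords_mem_rootList {r : Lattice} (hr : IsRoot r) : coords r ∈ rootList := by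
  have hr' : form r r = 2 := hr
  obtain ⟨h0, h1, h2, h3, h4, h5⟩ := sq_le_of_form r
  rw [hr'] at h0 h1 h2 h3 h4 h5
  rw [form_apply] at hr'
  exact mem_rootList_of_small _ (mem_intsUpTo (by norm_num; omega)) _
    (mem_intsUpTo (by norm_num; omega)) _ (mem_intsUpTo (by norm_num; omega)) _
    (mem_intsUpTo (by norm_num; omega)) _ (mem_intsUpTo (by norm_num; omega)) _
    (mem_intsUpTo (by norm_num; omega)) (by linarith)

/-! ### Walls of the fundamental chamber -/

/-- The vector of `D₄⁺` with inner products `m₁, m₂, m₃, m₄` with `α₂`, `α₄`, `α₃`, `α₁`. -/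
def weightVector (m₁ m₂ m₃ m₄ : ℤ) : Lattice :=
  ![m₁ + 2 * m₂ + 3 * m₃ + 2 * m₄, 2 * m₁ + 3 * m₂ + 4 * m₃ + 2 * m₄,
    2 * m₁ + 4 * m₂ + 6 * m₃ + 3 * m₄, 3 * m₁ + 6 * m₂ + 8 * m₃ + 4 * m₄,
    2 * m₁ + 4 * m₂ + 6 * m₃ + 3 * m₄, m₁ + 2 * m₂ + 3 * m₃ + 2 * m₄]

/-- Half the square of `weightVector m₁ m₂ m₃ m₄`. -/
def halfNorm (m₁ m₂ m₃ m₄ : ℤ) : ℤ :=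
  m₁ ^ 2 + 3 * m₂ ^ 2 + 6 * m₃ ^ 2 + 2 * m₄ ^ 2 + 3 * m₁ * m₂ + 4 * m₁ * m₃ + 2 * m₁ * m₄
    + 8 * m₂ * m₃ + 4 * m₂ * m₄ + 6 * m₃ * m₄

theorem weightVector_mem_D4Plus (m₁ m₂ m₃ m₄ : ℤ) : weightVector m₁ m₂ m₃ m₄ ∈ D4Plus :=
  (mem_D4Plus_iff _).mpr ⟨rfl, rfl⟩

theorem form_weightVector (m₁ m₂ m₃ m₄ : ℤ) (r : Lattice) : form (weightVector m₁ m₂ m₃ m₄) r =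
    m₁ * r 1 + m₂ * r 3 + m₃ * (r 2 + r 4) + m₄ * (r 0 + r 5) := by
  simp [form_apply, weightVector]
  ring

theorem form_weightVector_self (m₁ m₂ m₃ m₄ : ℤ) :
    form (weightVector m₁ m₂ m₃ m₄) (weightVector m₁ m₂ m₃ m₄) = 2 * halfNorm m₁ m₂ m₃ m₄ := by
  rw [form_weightVector]
  simp [weightVector, halfNorm]
  ring

theorem same_sign_of_mem_rootList : ∀ v ∈ rootList,
    (0 ≤ v.1 ∧ 0 ≤ v.2.1 ∧ 0 ≤ v.2.2.1 ∧ 0 ≤ v.2.2.2.1 ∧ 0 ≤ v.2.2.2.2.1 ∧ 0 ≤ v.2.2.2.2.2) ∨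
    (v.1 ≤ 0 ∧ v.2.1 ≤ 0 ∧ v.2.2.1 ≤ 0 ∧ v.2.2.2.1 ≤ 0 ∧ v.2.2.2.2.1 ≤ 0 ∧
      v.2.2.2.2.2 ≤ 0) := by
  decide +kernel

theorem encard_orthogonalRoots_lt {l : Lattice} {P : ℤ × ℤ × ℤ × ℤ × ℤ × ℤ → Prop}
    [DecidablePred P] (h : ∀ r ∈ orthogonalRoots l, P (coords r))
    (hP : (rootList.toFinset.filter P).card < 18) : (orthogonalRoots l).encard < 18 := by
  have hsub : orthogonalRoots l ⊆ ofCoords '' (rootList.toFinset.filter P : Set _) := by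
    intro r hr
    refine ⟨coords r, ?_, ofCoords_coords r⟩
    simpa using ⟨coords_mem_rootList hr.1, h r hr⟩
  refine ((Set.encard_le_encard hsub).trans (Set.encard_image_le _ _)).trans_lt ?_
  rw [Set.encard_coe_eq_coe_finsetCard]
  exact_mod_cast hP

/-- The coordinates of a root share one sign, so orthogonality to a dominant vector kills each term
separately. -/
theorem encard_orthogonalRoots_weightVector_lt {m₁ m₂ m₃ m₄ : ℤ} (h₁ : 0 ≤ m₁) (h₂ : 0 ≤ m₂)
    (h₃ : 0 ≤ m₃) (h₄ : 0 ≤ m₄) (h : 0 < m₂ ∨ 0 < m₃ ∨ (0 < m₁ ∧ 0 < m₄)) :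
    (orthogonalRoots (weightVector m₁ m₂ m₃ m₄)).encard < 18 := by
  have key : ∀ r ∈ orthogonalRoots (weightVector m₁ m₂ m₃ m₄), m₁ * r 1 = 0 ∧ m₂ * r 3 = 0 ∧
      m₃ * (r 2 + r 4) = 0 ∧ m₄ * (r 0 + r 5) = 0 := by
    rintro r ⟨hr, hlr⟩
    rw [form_weightVector] at hlr
    rcases same_sign_of_mem_rootList _ (coords_mem_rootList hr) with hs | hs
    all_goals
      simp only [coords] at hs
      obtain ⟨a0, a1, a2, a3, a4, a5⟩ := hs
    · have e1 := mul_nonneg h₁ a1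
      have e2 := mul_nonneg h₂ a3
      have e3 := mul_nonneg h₃ (add_nonneg a2 a4)
      have e4 := mul_nonneg h₄ (add_nonneg a0 a5)
      refine ⟨?_, ?_, ?_, ?_⟩ <;> linarith
    · have e1 := mul_nonpos_of_nonneg_of_nonpos h₁ a1
      have e2 := mul_nonpos_of_nonneg_of_nonpos h₂ a3
      have e3 := mul_nonpos_of_nonneg_of_nonpos h₃ (add_nonpos a2 a4)
      have e4 := mul_nonpos_of_nonneg_of_nonpos h₄ (add_nonpos a0 a5)
      refine ⟨?_, ?_, ?_, ?_⟩ <;> linarith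
  rcases h with h | h | ⟨h, h'⟩
  · refine encard_orthogonalRoots_lt (P := fun v => v.2.2.2.1 = 0) (fun r hr => ?_)
      (by decide +kernel)
    simpa [coords, h.ne'] using (key r hr).2.1
  · refine encard_orthogonalRoots_lt (P := fun v => v.2.2.1 + v.2.2.2.2.1 = 0) (fun r hr => ?_)
      (by decide +kernel)
    simpa [coords, h.ne'] using (key r hr).2.2.1
  · refine encard_orthogonalRoots_lt (P := fun v => v.2.1 = 0 ∧ v.1 + v.2.2.2.2.2 = 0)
      (fun r hr => ?_) (by decide +kernel)
    simpa [coords, h.ne', h'.ne'] using And.intro (key r hr).1 (key r hr).2.2.2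

theorem isRoot_simpleRoot (k : Fin 6) : IsRoot (simpleRoot k) := by
  rw [IsRoot, form_simpleRoot]
  fin_cases k <;> rfl

/-- `2d` is the square of a vector of `D₄⁺` lying in the closed fundamental chamber, on one of
its walls, but not on one of its two edges whose vectors are orthogonal to at least `18` roots. -/
def IsWallNorm (d : ℤ) : Prop :=
  ∃ m₁ m₂ m₃ m₄ : ℤ, 0 ≤ m₁ ∧ 0 ≤ m₂ ∧ 0 ≤ m₃ ∧ 0 ≤ m₄ ∧
    (m₁ = 0 ∨ m₂ = 0 ∨ m₃ = 0 ∨ m₄ = 0) ∧ (0 < m₂ ∨ 0 < m₃ ∨ (0 < m₁ ∧ 0 < m₄)) ∧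
    halfNorm m₁ m₂ m₃ m₄ = d

theorem IsWallNorm.exists_vector {d : ℤ} (hd : IsWallNorm d) :
    ∃ l : Lattice, l ∈ D4Plus ∧ form l l = 2 * d ∧
      (orthogonalRoots l).Nonempty ∧ (orthogonalRoots l).encard < 18 := by
  obtain ⟨m₁, m₂, m₃, m₄, h₁, h₂, h₃, h₄, h0, h, rfl⟩ := hd
  refine ⟨weightVector m₁ m₂ m₃ m₄, weightVector_mem_D4Plus .., form_weightVector_self .., ?_,
    encard_orthogonalRoots_weightVector_lt h₁ h₂ h₃ h₄ h⟩
  rcases h0 with h0 | h0 | h0 | h0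
  · exact ⟨simpleRoot 1, isRoot_simpleRoot 1, by simp [form_weightVector, simpleRoot, h0]⟩
  · exact ⟨simpleRoot 3, isRoot_simpleRoot 3, by simp [form_weightVector, simpleRoot, h0]⟩
  · exact ⟨simpleRoot 2, isRoot_simpleRoot 2, by simp [form_weightVector, simpleRoot, h0]⟩
  · exact ⟨simpleRoot 0, isRoot_simpleRoot 0, by simp [form_weightVector, simpleRoot, h0]⟩

theorem IsWallNorm.sq_mul {d k : ℤ} (hd : IsWallNorm d) (hk : 0 < k) :
    IsWallNorm (k ^ 2 * d) := by
  obtain ⟨m₁, m₂, m₃, m₄, h₁, h₂, h₃, h₄, h0, h, rfl⟩ := hd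
  refine ⟨k * m₁, k * m₂, k * m₃, k * m₄, by positivity, by positivity, by positivity,
    by positivity, ?_, ?_, by unfold halfNorm; ring⟩
  · simpa [hk.ne'] using h0
  · simpa [hk] using h

theorem exists_sorted_sum_three_squares (x y z : ℤ) : ∃ a b c : ℤ, 0 ≤ c ∧ c ≤ b ∧ b ≤ a ∧
    (x ≠ 0 → y ≠ 0 → 0 < b) ∧ a ^ 2 + b ^ 2 + c ^ 2 = x ^ 2 + y ^ 2 + z ^ 2 := by
  wlog hx : 0 ≤ x generalizing x
  · simpa using this (-x) (by omega)
  wlog hy : 0 ≤ y generalizing y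
  · simpa using this (-y) (by omega)
  wlog hz : 0 ≤ z generalizing z
  · simpa using this (-z) (by omega)
  rcases le_total x y with h1 | h1 <;> rcases le_total y z with h2 | h2 <;>
    rcases le_total x z with h3 | h3
  all_goals first
    | exact ⟨x, y, z, hz, h2, h1, by omega, by ring⟩
    | exact ⟨x, z, y, hy, h2, h3, by omega, by ring⟩
    | exact ⟨y, x, z, hz, h3, h1, by omega, by ring⟩
    | exact ⟨y, z, x, hx, h3, h2, by omega, by ring⟩
    | exact ⟨z, x, y, hy, h1, h3, by omega, by ring⟩
    | exact ⟨z, y, x, hx, h1, h2, by omega, by ring⟩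

theorem isWallNorm_of_sum_three_squares {x y z d : ℤ} (h : x ^ 2 + y ^ 2 + z ^ 2 = d)
    (h1 : (∀ k : ℤ, d ≠ k ^ 2) ∨ x ≠ 0 ∧ y ≠ 0) (h2 : ∀ k : ℤ, d ≠ 2 * k ^ 2) : IsWallNorm d := by
  obtain ⟨a, b, c, hc, hcb, hba, hxy, e⟩ := exists_sorted_sum_three_squares x y z
  rw [h] at e
  -- With c = 0, the cases b = 0 and b = a are the two excluded edges.
  have hb : c = 0 → 0 < b ∧ b < a := by
    rintro rfl
    constructor
    · rcases h1 with h1 | h1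
      · by_contra hb0
        obtain rfl : b = 0 := by omega
        exact h1 a (by linarith)
      · exact hxy h1.1 h1.2
    · by_contra hb0
      obtain rfl : b = a := by omega
      exact h2 b (by linarith)
  by_cases hab : c ≤ a - b
  · exact ⟨a - b - c, 0, c, b - c, by omega, by omega, by omega, by omega, by omega, by omega,
      by rw [← e]; unfold halfNorm; ring⟩
  · exact ⟨0, c + b - a, a - b, b - c, by omega, by omega, by omega, by omega, by omega, by omega,
      by rw [← e]; unfold halfNorm; ring⟩

theorem isWallNorm_of_two_mul_sum_three_squares {x y z d : ℤ} (h : x ^ 2 + y ^ 2 + z ^ 2 = 2 * d)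
    (h1 : (∀ k : ℤ, 2 * d ≠ k ^ 2) ∨ x ≠ 0 ∧ y ≠ 0) (h2 : ∀ k : ℤ, d ≠ k ^ 2) : IsWallNorm d := by
  obtain ⟨a, b, c, hc, hcb, hba, hxy, e⟩ := exists_sorted_sum_three_squares x y z
  rw [h] at e
  have hb : c = 0 → 0 < b ∧ b < a := by
    rintro rfl
    constructor
    · rcases h1 with h1 | h1
      · by_contra hb0
        obtain rfl : b = 0 := by omega
        exact h1 a (by linarith)
      · exact hxy h1.1 h1.2
    · by_contra hb0
      obtain rfl : b = a := by omega
      exact h2 b (by linarith)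
  -- The sum of squares is even, hence so is a - b - c; the sign of t selects the wall m₃ = 0 or m₄
  -- = 0.
  obtain ⟨t, ht⟩ : ∃ t, a = b + c + 2 * t := by
    have hev : Even (a ^ 2 + b ^ 2 + c ^ 2) := ⟨d, by linarith⟩
    have : Even (a - b - c) := by
      simp only [Int.even_add, Int.even_sub, Int.even_pow, ne_eq, OfNat.ofNat_ne_zero,
        not_false_eq_true, and_true] at hev ⊢
      tauto
    obtain ⟨t, ht⟩ := this
    exact ⟨t, by linarith⟩
  subst ht
  have e' : d = b ^ 2 + c ^ 2 + b * c + 2 * b * t + 2 * c * t + 2 * t ^ 2 := by linarith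
  rcases le_total 0 t with ht | ht
  · exact ⟨b - c, c, 0, t, by omega, by omega, by omega, by omega, by omega, by omega,
      by rw [e']; unfold halfNorm; ring⟩
  · exact ⟨b - c, c + 2 * t, -t, 0, by omega, by omega, by omega, by omega, by omega, by omega,
      by rw [e']; unfold halfNorm; ring⟩

/-! ### Powers of two -/

theorem many_orthogonal_of_small :
    ∀ a ∈ intsUpTo 2, ∀ b ∈ intsUpTo 2, ∀ c ∈ intsUpTo 3, ∀ d ∈ intsUpTo 4,
      2 * (a * a) + b * b + 2 * (c * c) + d * d - 2 * (a * c) - 2 * (c * d) - b * d = 1 ∨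
      2 * (a * a) + b * b + 2 * (c * c) + d * d - 2 * (a * c) - 2 * (c * d) - b * d = 2 →
      18 ≤ (rootList.toFinset.filter fun v => (2 * a - c) * (v.1 + v.2.2.2.2.2) +
        (2 * b - d) * v.2.1 + (2 * c - a - d) * (v.2.2.1 + v.2.2.2.2.1) +
        (2 * d - b - 2 * c) * v.2.2.2.1 = 0).card := by
  decide +kernel

theorem norm_of_mem_rootList : ∀ v ∈ rootList,
    v.1 * (2 * v.1 - v.2.2.1) + v.2.1 * (2 * v.2.1 - v.2.2.2.1) +
      v.2.2.1 * (2 * v.2.2.1 - v.1 - v.2.2.2.1) +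
      v.2.2.2.1 * (2 * v.2.2.2.1 - v.2.1 - v.2.2.1 - v.2.2.2.2.1) +
      v.2.2.2.2.1 * (2 * v.2.2.2.2.1 - v.2.2.2.1 - v.2.2.2.2.2) +
      v.2.2.2.2.2 * (2 * v.2.2.2.2.2 - v.2.2.2.2.1) = 2 := by
  decide +kernel

theorem isRoot_ofCoords {v : ℤ × ℤ × ℤ × ℤ × ℤ × ℤ} (hv : v ∈ rootList) :
    IsRoot (ofCoords v) := by
  rw [IsRoot, form_apply]
  exact norm_of_mem_rootList v hv

theorem le_encard_orthogonalRoots {l : Lattice} (hl : l ∈ D4Plus)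
    (h : form l l = 2 ∨ form l l = 4) : 18 ≤ (orthogonalRoots l).encard := by
  obtain ⟨h05, h24⟩ := (mem_D4Plus_iff l).mp hl
  obtain ⟨b0, b1, b2, b3, -, -⟩ := sq_le_of_form l
  have hle : form l l ≤ 4 := by omega
  have hcard := many_orthogonal_of_small (l 0) (mem_intsUpTo (by norm_num; omega)) (l 1)
    (mem_intsUpTo (by norm_num; omega)) (l 2) (mem_intsUpTo (by norm_num; omega)) (l 3)
    (mem_intsUpTo (by norm_num; omega)) (by
      rw [form_apply, ← h05, ← h24] at h
      rcases h with h | h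
      · left; linarith
      · right; linarith)
  set S := rootList.toFinset.filter fun v => (2 * l 0 - l 2) * (v.1 + v.2.2.2.2.2) +
        (2 * l 1 - l 3) * v.2.1 + (2 * l 2 - l 0 - l 3) * (v.2.2.1 + v.2.2.2.2.1) +
        (2 * l 3 - l 1 - 2 * l 2) * v.2.2.2.1 = 0
  have hsub : ofCoords '' (S : Set _) ⊆ orthogonalRoots l := by
    rintro _ ⟨v, hv, rfl⟩
    obtain ⟨hv, hv0⟩ := Finset.mem_filter.mp hv
    refine ⟨isRoot_ofCoords (List.mem_toFinset.mp hv), ?_⟩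
    rw [form_apply, ← h05, ← h24, ← hv0]
    simp [ofCoords]
    ring
  have hinj : Function.Injective ofCoords := fun v w h => by
    rw [← coords_ofCoords v, h, coords_ofCoords]
  refine le_trans ?_ (Set.encard_le_encard hsub)
  rw [hinj.encard_image, Set.encard_coe_eq_coe_finsetCard]
  exact_mod_cast hcard

/-- Evenness of all coordinates depends only on residues mod 4, which makes the descent step a
finite check. -/
theorem even_of_orthogonal_mod_four : ∀ v ∈ rootList, ∀ a b c d : ZMod 4,
    (2 * a - c) * ((v.1 + v.2.2.2.2.2 : ℤ) : ZMod 4) +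
        (2 * b - d) * ((v.2.1 : ℤ) : ZMod 4) +
        (2 * c - a - d) * ((v.2.2.1 + v.2.2.2.2.1 : ℤ) : ZMod 4) +
        (2 * d - b - 2 * c) * ((v.2.2.2.1 : ℤ) : ZMod 4) = 0 →
    2 * (a * a) + b * b + 2 * (c * c) + d * d - 2 * (a * c) - 2 * (c * d) - b * d = 0 →
    2 * a = 0 ∧ 2 * b = 0 ∧ 2 * c = 0 ∧ 2 * d = 0 := by
  decide +kernel

theorem exists_two_smul {l r : Lattice} (hl : l ∈ D4Plus) (hr : r ∈ orthogonalRoots l) {k : ℤ}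
    (h : form l l = 8 * k) : ∃ l' ∈ D4Plus, l = (2 : ℤ) • l' := by
  obtain ⟨h05, h24⟩ := (mem_D4Plus_iff l).mp hl
  have hq : 2 * (l 0 * l 0) + l 1 * l 1 + 2 * (l 2 * l 2) + l 3 * l 3 - 2 * (l 0 * l 2)
      - 2 * (l 2 * l 3) - l 1 * l 3 = 4 * k := by
    rw [form_apply, ← h05, ← h24] at h
    linarith
  have hlr := hr.2
  rw [form_apply, ← h05, ← h24] at hlr
  have h4 : (4 : ZMod 4) = 0 := rfl
  have hev (x : ℤ) (hx : 2 * (x : ZMod 4) = 0) : ∃ y, x = 2 * y := by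
    have : ((2 * x : ℤ) : ZMod 4) = 0 := by push_cast; exact hx
    obtain ⟨y, hy⟩ := (ZMod.intCast_zmod_eq_zero_iff_dvd _ _).mp this
    exact ⟨y, by push_cast at hy; linarith⟩
  obtain ⟨e0, e1, e2, e3⟩ := even_of_orthogonal_mod_four _ (coords_mem_rootList hr.1)
    (l 0) (l 1) (l 2) (l 3)
    (by
      have := congrArg (Int.cast : ℤ → ZMod 4) hlr
      simp only [coords]
      push_cast at this ⊢
      linear_combination this)
    (by
      have := congrArg (Int.cast : ℤ → ZMod 4) hq
      push_cast at this
      rw [this, h4, zero_mul])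
  obtain ⟨a, ha⟩ := hev _ e0
  obtain ⟨b, hb⟩ := hev _ e1
  obtain ⟨c, hc⟩ := hev _ e2
  obtain ⟨d, hd⟩ := hev _ e3
  refine ⟨![a, b, c, d, c, a], (mem_D4Plus_iff _).mpr ⟨rfl, rfl⟩, ?_⟩
  funext i
  fin_cases i
  · simpa using ha
  · simpa using hb
  · simpa using hc
  · simpa using hd
  · simpa [← h24] using hc
  · simpa [← h05] using ha

theorem orthogonalRoots_two_smul (l : Lattice) :
    orthogonalRoots ((2 : ℤ) • l) = orthogonalRoots l := by
  ext r
  simp only [orthogonalRoots, map_smul, LinearMap.smul_apply, smul_eq_mul, Set.mem_ofPred_eq,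
    mul_eq_zero, OfNat.ofNat_ne_zero, false_or]

/-- A vector of `D₄⁺` of square `2 ^ (n + 1)` that is orthogonal to a root is orthogonal to at
least `18` roots. -/
theorem le_encard_orthogonalRoots_of_two_pow (n : ℕ) {l : Lattice} (hl : l ∈ D4Plus)
    (h : form l l = 2 * 2 ^ n) (hne : (orthogonalRoots l).Nonempty) :
    18 ≤ (orthogonalRoots l).encard := by
  induction n using Nat.twoStepInduction generalizing l with
  | zero => exact le_encard_orthogonalRoots hl (Or.inl h)
  | one => exact le_encard_orthogonalRoots hl (Or.inr h)
  | more n ih _ =>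
    obtain ⟨r, hr⟩ := hne
    obtain ⟨l', hl', rfl⟩ := exists_two_smul (k := 2 ^ n) hl hr (by rw [h]; ring)
    rw [orthogonalRoots_two_smul] at hr ⊢
    refine ih hl' ?_ ⟨r, hr⟩
    simp only [map_smul, LinearMap.smul_apply, smul_eq_mul, pow_add] at h
    linarith

/-! ### Integers that are not powers of two -/

theorem isWallNorm_of_ne_sq (d : ℕ) (h1 : ∀ k : ℤ, (d : ℤ) ≠ k ^ 2)
    (h2 : ∀ k : ℤ, (d : ℤ) ≠ 2 * k ^ 2) : IsWallNorm d := by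
  induction d using Nat.strong_induction_on with
  | _ d ih =>
  have hd0 : d ≠ 0 := fun h => h1 0 (by simp [h])
  by_cases hd4 : d % 4 = 0
  · obtain ⟨e, rfl⟩ := Nat.dvd_of_mod_eq_zero hd4
    have := (ih e (by omega) (fun k hk => h1 (2 * k) (by push_cast; rw [hk]; ring))
      (fun k hk => h2 (2 * k) (by push_cast; rw [hk]; ring))).sq_mul (k := 2) (by norm_num)
    push_cast
    exact this
  by_cases hd2 : d % 4 = 2
  · obtain ⟨x, y, z, h⟩ := sum_three_squares_of_mod_four_eq_two d hd2
    exact isWallNorm_of_sum_three_squares h (Or.inl h1) h2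
  · obtain ⟨x, y, z, h⟩ := sum_three_squares_of_mod_four_eq_two (2 * d) (by omega)
    push_cast at h
    refine isWallNorm_of_two_mul_sum_three_squares h (Or.inl fun k hk => ?_) h1
    obtain ⟨j, rfl⟩ : Even k := by
      rw [← Int.even_pow' two_ne_zero, ← hk]
      exact even_two_mul _
    exact h2 j (by linarith)

theorem ne_two_mul_sq_of_prime_sq {p : ℕ} (hp : p.Prime) (k : ℤ) : (p : ℤ) ^ 2 ≠ 2 * k ^ 2 := by
  intro h
  have hk : k ≠ 0 := by
    rintro rfl
    exact hp.ne_zero (by simpa using h)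
  apply irrational_sqrt_two.ne_rat (|(p : ℚ) / k|)
  have hk' : (k : ℝ) ≠ 0 := by exact_mod_cast hk
  have h' : (p : ℝ) ^ 2 = 2 * (k : ℝ) ^ 2 := by exact_mod_cast h
  push_cast
  rw [← Real.sqrt_sq_eq_abs, div_pow, h', mul_div_assoc, div_self (by positivity), mul_one]

theorem isWallNorm_prime_sq {p : ℕ} (hp : p.Prime) (hp2 : p ≠ 2) :
    IsWallNorm ((p : ℤ) ^ 2) ∧ IsWallNorm (2 * (p : ℤ) ^ 2) := by
  obtain ⟨x, y, z, hx, hy, h⟩ := prime_sq_sum_three_squares p hp hp2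
  refine ⟨isWallNorm_of_sum_three_squares h (Or.inr ⟨hx, hy⟩) (ne_two_mul_sq_of_prime_sq hp),
    isWallNorm_of_two_mul_sum_three_squares (x := 2 * x) (y := 2 * y) (z := 2 * z)
      (by linear_combination 4 * h) (Or.inr ⟨by simpa using hx, by simpa using hy⟩)
      fun k hk => ?_⟩
  obtain ⟨j, rfl⟩ : Even k := by
    rw [← Int.even_pow' two_ne_zero, ← hk]
    exact even_two_mul _
  exact ne_two_mul_sq_of_prime_sq hp j (by linarith)

theorem isWallNorm_of_ne_two_pow (d : ℕ) (hd : 0 < d) (h : ∀ n : ℕ, d ≠ 2 ^ n) :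
    IsWallNorm d := by
  have hfac (k : ℤ) (hk : k ≠ 0) (hk2 : ∀ n, k.natAbs ≠ 2 ^ n) :
      ∃ (p : ℕ) (j : ℤ), p.Prime ∧ p ≠ 2 ∧ 0 < j ∧ k ^ 2 = j ^ 2 * (p : ℤ) ^ 2 := by
    rcases Nat.eq_two_pow_or_exists_odd_prime_and_dvd k.natAbs with ⟨n, hn⟩ | ⟨p, hp, ⟨j, hj⟩, ho⟩
    · exact absurd hn (hk2 n)
    · refine ⟨p, j, hp, by rintro rfl; exact absurd ho (by decide), ?_, ?_⟩
      · have : j ≠ 0 := by rintro rfl; simp at hj; exact hk hj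
        positivity
      · rw [← Int.natAbs_sq, hj]; push_cast; ring
  by_cases h1 : ∃ k : ℤ, (d : ℤ) = k ^ 2
  · obtain ⟨k, hk⟩ := h1
    obtain ⟨p, j, hp, hp2, hj, e⟩ := hfac k (by rintro rfl; simp at hk; omega) (fun n hn => by
      apply h (2 * n)
      rw [← Int.natAbs_sq, hn] at hk
      zify
      rw [hk]
      push_cast
      ring)
    rw [hk, e]
    exact (isWallNorm_prime_sq hp hp2).1.sq_mul hj
  by_cases h2 : ∃ k : ℤ, (d : ℤ) = 2 * k ^ 2
  · obtain ⟨k, hk⟩ := h2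
    obtain ⟨p, j, hp, hp2, hj, e⟩ := hfac k (by rintro rfl; simp at hk; omega) (fun n hn => by
      apply h (2 * n + 1)
      rw [← Int.natAbs_sq, hn] at hk
      zify
      rw [hk]
      push_cast
      ring)
    rw [hk, e, mul_left_comm]
    exact (isWallNorm_prime_sq hp hp2).2.sq_mul hj
  exact isWallNorm_of_ne_sq d (not_exists.mp h1) (not_exists.mp h2)

end E6

theorem lemma5p5 (d : ℕ) (hd : 0 < d) :
    (∃ l : E6.Lattice, l ∈ E6.D4Plus ∧ E6.form l l = 2 * (d : ℤ) ∧
        (E6.orthogonalRoots l).Nonempty ∧ (E6.orthogonalRoots l).encard < 18) ↔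
      ∀ n : ℕ, d ≠ 2 ^ n := by
  constructor
  · rintro ⟨l, hl, hn, hne, hlt⟩ n rfl
    push_cast at hn
    exact hlt.not_ge (E6.le_encard_orthogonalRoots_of_two_pow n hl hn hne)
  · exact fun h => (E6.isWallNorm_of_ne_two_pow d hd h).exists_vector
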